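/- **Proposition (Escaping saddles).** Let $d\ge1$, let $\mathcal D$ be a probability distribution on a measurable space $\mathcal Z$, and let $F:\mathbb R^d\times\mathcal Z\to\mathbb R$ be such that $F(x;\cdot)$ is measurable and $\mathcal D$-integrable for every $x$ and $F(\cdot;z)$ is differentiable for every $z$. Put $f(x)=\mathbb E_{\zeta\sim\mathcal D}F(x;\zeta)$, and let $\nabla F(x;z)$ be the gradient in $x$. Let $L,\rho,\sigma,\varepsilon,\eta>0$ and $p\in(0,1)$. Assume: 1. (Smoothness) $\|\nabla F(x;z)-\nabla F(x';z)\|\le L\|x-x'\|$ for all $x,x'\in\mathbb R^d$, $z\in\mathcal Z$; $f$ is $C^2$ and $\|\nabla^2f(x)-\nabla^2f(x')\|\le\rho\|x-x'\|$ for all $x,x'$ (spectral norm). 2. (Noise) Either for every $x$, $\|\nabla F(x;\zeta)-\nabla f(x)\|^2\le\sigma^2$ for $\mathcal D$-almost every $\zeta$; or for every $x$, $\mathbb E_{\zeta\sim\mathcal D}\exp\big(\|\nabla F(x;\zeta)-\nabla f(x)\|^2/\sigma^2\big)\le e$. 3. (Dispersive noise) For every $x\in\mathbb R^d$, every unit vector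 $v$, and every Borel set $A\subseteq\mathbb R^d$ such that $u+qv\notin A$ whenever $u\in A$ and $q\ge\sigma/(4\sqrt d)$, we have $\mathbb P_{\zeta\sim\mathcal D}(\nabla F(x;\zeta)\in A)\le\frac14$. 4. (Parameters) With $$N=\Big\lfloor\frac{\log(3/p)}{\log(1/0.7)}\Big\rfloor+1,\quad \tilde C_1=2N\log\frac{24\sqrt d}{\eta},\quad \delta=\sqrt{\rho\varepsilon},\quad \delta_2=16\delta,\quad B=\frac{\delta}{\rho\tilde C_1},$$ $$K_o=\frac{2\log(24\sqrt d/\eta)}{\eta\,\delta_2},\qquad K_0=N K_o=\frac{\tilde C_1}{\eta\,\delta_2},$$ we have $K_0\ge1$, $\delta\le1$, $B\le\min(1,\sigma/L,1/L)$ and $$\eta\le\frac{B^2\delta}{64\max(\sigma^2,1)\,\tilde C_1\log(48K_0/p)}\cdot\frac1{3+\log K_0}.$$ Let $\zeta^1,\zeta^2,\dots$ be independent random variables with law $\mathcal D$, let $x^0\in\mathbb R^d$ satisfy $\lambda_{\min}(\nabla^2f(x^0))\le-\delta_2$, and let $x^{k+1}=x^k-\eta\nabla F(x^k;\zeta^{k+1})$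 for $k\ge0$. Let $\mathscr K_0=\inf\{k\ge0:\|x^k-x^0\|>B\}$ (with $\inf\emptyset=\infty$). Then $$\mathbb P(\mathscr K_0\le K_0)\ge1-\frac p3 .$$ -/

import Mathlib

open MeasureTheory ProbabilityTheory
open scoped ENNReal

noncomputable section

namespace SGDEscape

/-- The Euclidean space `ℝ^d`. -/
abbrev E (d : ℕ) : Type := EuclideanSpace ℝ (Fin d)

/-! ### The stochastic objective -/

/-- The stochastic gradient `∇F(x; z)`, the gradient in the first variable. -/
def stochGrad {d : ℕ} {Z : Type*} (F : E d → Z → ℝ) (x : E d) (z : Z) : E d :=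
  gradient (fun y => F y z) x

/-- The objective `f(x) = 𝔼_{ζ ∼ D} F(x; ζ)`. -/
def objective {d : ℕ} {Z : Type*} [MeasurableSpace Z] (F : E d → Z → ℝ) (D : Measure Z)
    (x : E d) : ℝ :=
  ∫ z, F x z ∂D

/-- The Hessian `∇²f(x)` as a linear operator; its norm is the spectral norm. -/
def hessian {d : ℕ} (f : E d → ℝ) (x : E d) : E d →L[ℝ] E d :=
  fderiv ℝ (gradient f) x

/-- The least eigenvalue of a (symmetric) operator on `ℝ^d`. (The value for `d = 0` is `0`.) -/
def lambdaMin {d : ℕ} (A : E d →L[ℝ] E d) : ℝ :=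
  sInf {μ : ℝ | Module.End.HasEigenvalue (A : E d →ₗ[ℝ] E d) μ}

/-- `F(x; ·)` is a random variable with finite mean for every `x`, and `F(·; z)` is differentiable
for every `z`, so that the objective and the stochastic gradients make sense. -/
structure IsStochasticObjective {d : ℕ} {Z : Type*} [MeasurableSpace Z] (F : E d → Z → ℝ)
    (D : Measure Z) : Prop where
  measurable : ∀ x, Measurable (F x)
  integrable : ∀ x, Integrable (F x) D
  differentiable : ∀ z, Differentiable ℝ (fun x => F x z)

/-- Smoothness: stochastic gradients are `L`-Lipschitz; `f` is twice continuously differentiable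
with `ρ`-Lipschitz Hessian. -/
structure Smoothness {d : ℕ} {Z : Type*} [MeasurableSpace Z] (F : E d → Z → ℝ)
    (D : Measure Z) (L ρ : ℝ) : Prop where
  grad_lipschitz : ∀ z x x', ‖stochGrad F x z - stochGrad F x' z‖ ≤ L * ‖x - x'‖
  contDiff : ContDiff ℝ 2 (objective F D)
  hessian_lipschitz : ∀ x x',
    ‖hessian (objective F D) x - hessian (objective F D) x'‖ ≤ ρ * ‖x - x'‖

/-- Bounded noise: `‖∇F(x; ζ) - ∇f(x)‖² ≤ σ²` almost surely, for every `x`. -/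
def BoundedNoise {d : ℕ} {Z : Type*} [MeasurableSpace Z] (F : E d → Z → ℝ)
    (D : Measure Z) (σ : ℝ) : Prop :=
  ∀ x, ∀ᵐ z ∂D, ‖stochGrad F x z - gradient (objective F D) x‖ ^ 2 ≤ σ ^ 2

/-- Norm-subgaussian noise: `𝔼 exp(‖∇F(x; ζ) - ∇f(x)‖² / σ²) ≤ e`, for every `x`. -/
def SubgaussianNoise {d : ℕ} {Z : Type*} [MeasurableSpace Z] (F : E d → Z → ℝ)
    (D : Measure Z) (σ : ℝ) : Prop :=
  ∀ x, ∫⁻ z, ENNReal.ofReal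
      (Real.exp (‖stochGrad F x z - gradient (objective F D) x‖ ^ 2 / σ ^ 2)) ∂D
    ≤ ENNReal.ofReal (Real.exp 1)

/-! ### Dispersive noise -/

/-- The `(q, v)`-narrow property of a Borel set `A`. -/
def IsNarrow {d : ℕ} (q : ℝ) (v : E d) (A : Set (E d)) : Prop :=
  MeasurableSet A ∧ ∀ u ∈ A, ∀ r : ℝ, q ≤ r → u + r • v ∈ Aᶜ

/-- The `v`-dispersive property (at noise level `σ`) of a random vector `X` on `(Z, D)`. -/
def IsDispersive {d : ℕ} {Z : Type*} [MeasurableSpace Z] (D : Measure Z) (σ : ℝ) (v : E d)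
    (X : Z → E d) : Prop :=
  ∀ A : Set (E d), IsNarrow (σ / (4 * √(d : ℝ))) v A → D {z | X z ∈ A} ≤ 1 / 4

/-- Dispersive noise: at every point, the stochastic gradient is `v`-dispersive for every unit
vector `v`. -/
def DispersiveNoise {d : ℕ} {Z : Type*} [MeasurableSpace Z] (F : E d → Z → ℝ)
    (D : Measure Z) (σ : ℝ) : Prop :=
  ∀ x v : E d, ‖v‖ = 1 → IsDispersive D σ v (stochGrad F x)

/-! ### Parameters -/

/-- The number of rounds `⌊log(3/p) / log(1/0.7)⌋ + 1`. -/
def rounds (p : ℝ) : ℕ := ⌊Real.log (3 / p) / Real.log (1 / 0.7)⌋₊ + 1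

/-- `C̃₁ = 2 (⌊log(3/p) / log(1/0.7)⌋ + 1) log(24 √d / η)`. -/
def tildeC (d : ℕ) (p η : ℝ) : ℝ := 2 * (rounds p : ℝ) * Real.log (24 * √(d : ℝ) / η)

/-- `δ = √(ρ ε)`. -/
def delta (ρ ε : ℝ) : ℝ := √(ρ * ε)

/-- `δ₂ = 16 δ`. -/
def deltaTwo (ρ ε : ℝ) : ℝ := 16 * delta ρ ε

/-- The radius `B = δ / (ρ C̃₁)`. -/
def radius (d : ℕ) (ρ ε p η : ℝ) : ℝ := delta ρ ε / (ρ * tildeC d p η)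

/-- The length of one round, `K_o = 2 log(24 √d / η) η⁻¹ δ₂⁻¹` (a real number). -/
def roundLength (d : ℕ) (ρ ε η : ℝ) : ℝ :=
  2 * Real.log (24 * √(d : ℝ) / η) * η⁻¹ * (deltaTwo ρ ε)⁻¹

/-- The number of steps `K₀ = (⌊log(3/p) / log(1/0.7)⌋ + 1) K_o` (a real number); it equals
`C̃₁ η⁻¹ δ₂⁻¹`. -/
def maxSteps (d : ℕ) (ρ ε p η : ℝ) : ℝ := (rounds p : ℝ) * roundLength d ρ ε η

lemma maxSteps_eq (d : ℕ) (ρ ε p η : ℝ) :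
    maxSteps d ρ ε p η = tildeC d p η * η⁻¹ * (deltaTwo ρ ε)⁻¹ := by
  unfold maxSteps roundLength tildeC; ring

/-- The parameter setting. The requirement `1 ≤ K₀` says that the method makes at least one
step. -/
structure ParameterSetting (d : ℕ) (L ρ σ ε p η : ℝ) : Prop where
  L_pos : 0 < L
  rho_pos : 0 < ρ
  sigma_pos : 0 < σ
  eps_pos : 0 < ε
  p_pos : 0 < p
  p_lt_one : p < 1
  eta_pos : 0 < η
  one_le_maxSteps : 1 ≤ maxSteps d ρ ε p η
  eta_le : η ≤ radius d ρ ε p η ^ 2 * delta ρ ε /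
      (64 * max (σ ^ 2) 1 * tildeC d p η * Real.log (48 * maxSteps d ρ ε p η / p)) *
      (1 / (3 + Real.log (maxSteps d ρ ε p η)))
  radius_le : radius d ρ ε p η ≤ min 1 (min (σ / L) (1 / L))
  delta_le : delta ρ ε ≤ 1

/-! ### The iteration -/

/-- The SGD iterates `x^{k+1} = x^k - η ∇F(x^k; ζ^{k+1})` started at `x₀`; the sample `ζ^{k+1}` is
`ζ k`. -/
def sgd {d : ℕ} {Z Ω : Type*} (F : E d → Z → ℝ) (η : ℝ) (ζ : ℕ → Ω → Z) (x₀ : E d) :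
    ℕ → Ω → E d
  | 0, _ => x₀
  | k + 1, ω => sgd F η ζ x₀ k ω - η • stochGrad F (sgd F η ζ x₀ k ω) (ζ k ω)

/-- The first `k` with `‖x^k - x^0‖ > B`; it is `∞` if there is none. -/
def exitTime {d : ℕ} {Ω : Type*} (x : ℕ → Ω → E d) (B : ℝ) (ω : Ω) : ℕ∞ :=
  ⨅ k ∈ {k : ℕ | B < ‖x k ω - x 0 ω‖}, (k : ℕ∞)

end SGDEscape

end

/-! Two copies of the iteration are run on the same samples from `u` and `u + q • v`, where `v` is a
unit eigenvector of the Hessian `H` at `x₀` for its least eigenvalue. In the ball of radius `B` the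
gradient of the objective is affine up to a `ρB`-Lipschitz error, so in mean the difference of the
copies is transported by nearly `1 - ηH`. This map stretches `v` by `g = 1 - η λ_min` and no vector
by more. Because the samples are shared, the fluctuation of the difference is proportional to the
difference itself, with factor `ηL`. Hence the difference, divided by `g ^ n * q`, stays near `v` in
mean square for a whole round (`ParameterBounds.deviation_le`), while `g ^ n * q` outgrows `4B`
(`ParameterBounds.growth`). Both copies therefore stay in the ball with probability at most 1/5
(`survival_coupled_le`).

Consequently the survival probabilities of the two starting points add up to at most 6/5, and they
cannot both exceed 3/5. The gradients that lead from a given point to one with survival above 3/5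
thus form a narrow set, which dispersive noise hits with probability at most 1/4. One round is then
survived with probability at most 3/5 + (2/5)(1/4) = 7/10 from every start (`survival_succ_le`). By
the Markov property `N` rounds are survived with probability at most `0.7 ^ N ≤ p / 3`.

Survival is a function of the starting point defined by recursion on `D` alone. The independence of
the samples matters only in passing to the actual iterates (`measure_forall_mem_le_survival`). -/

namespace SGDEscape

/-! ### Survival probabilities, coupling, and the Markov property -/

section Survival

variable {X Z : Type*} [MeasurableSpace Z]

/-- The probability that the random iteration `x ↦ φ x ζ`, `ζ ∼ D`, started at `x`, stays in `C` at
the times `0, …, n`. -/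
noncomputable def survival (D : Measure Z) (φ : X → Z → X) (C : Set X) : ℕ → X → ℝ≥0∞
  | 0 => C.indicator 1
  | n + 1 => C.indicator fun x => ∫⁻ z, survival D φ C n (φ x z) ∂D

variable {D : Measure Z} {φ : X → Z → X} {C : Set X}

lemma survival_of_notMem {x : X} (hx : x ∉ C) (n : ℕ) : survival D φ C n x = 0 := by
  cases n <;> simp [survival, hx]

lemma survival_succ_of_mem {x : X} (hx : x ∈ C) (n : ℕ) :
    survival D φ C (n + 1) x = ∫⁻ z, survival D φ C n (φ x z) ∂D := by
  simp [survival, hx]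

lemma survival_le_one [IsProbabilityMeasure D] (n : ℕ) (x : X) : survival D φ C n x ≤ 1 := by
  induction n generalizing x with
  | zero => exact Set.indicator_le_self' (by simp) x
  | succ n ih =>
    by_cases hx : x ∈ C
    · rw [survival_succ_of_mem hx]
      calc ∫⁻ z, survival D φ C n (φ x z) ∂D ≤ ∫⁻ _, 1 ∂D := lintegral_mono fun z => ih _
        _ = 1 := by simp
    · simp [survival_of_notMem hx]

variable [MeasurableSpace X]

lemma measurable_survival [SFinite D] (hφ : Measurable (Function.uncurry φ))
    (hC : MeasurableSet C) (n : ℕ) : Measurable (survival D φ C n) := by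
  induction n with
  | zero => exact measurable_one.indicator hC
  | succ n ih => exact (Measurable.lintegral_prod_right' (ih.comp hφ)).indicator hC

lemma measurable_survival_step [SFinite D] (hφ : Measurable (Function.uncurry φ))
    (hC : MeasurableSet C) (n : ℕ) (x : X) : Measurable fun z => survival D φ C n (φ x z) :=
  (measurable_survival hφ hC n).comp hφ.of_uncurry_left

/-- The Markov property: wherever the first `k` steps end, the remaining `m` cost a factor `c`. The
bound must be uniform in the start, since that point is random. -/
lemma survival_add_le [SFinite D] (hφ : Measurable (Function.uncurry φ)) (hC : MeasurableSet C)
    {m : ℕ} {c : ℝ≥0∞} (h : ∀ x, survival D φ C m x ≤ c) (k : ℕ) (x : X) :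
    survival D φ C (k + m) x ≤ c * survival D φ C k x := by
  induction k generalizing x with
  | zero =>
    by_cases hx : x ∈ C
    · simpa [survival, hx] using h x
    · simp [survival_of_notMem hx]
  | succ k ih =>
    by_cases hx : x ∈ C
    · rw [show k + 1 + m = k + m + 1 by ring, survival_succ_of_mem hx, survival_succ_of_mem hx,
        ← lintegral_const_mul _ (measurable_survival_step hφ hC k x)]
      exact lintegral_mono fun z => ih _
    · simp [survival_of_notMem hx]

lemma survival_mul_le [IsProbabilityMeasure D] (hφ : Measurable (Function.uncurry φ))
    (hC : MeasurableSet C) {m : ℕ} {c : ℝ≥0∞} (h : ∀ x, survival D φ C m x ≤ c) (N : ℕ) (x : X) :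
    survival D φ C (N * m) x ≤ c ^ N := by
  induction N generalizing x with
  | zero => simpa using survival_le_one 0 x
  | succ N ih =>
    rw [Nat.succ_mul, pow_succ']
    exact (survival_add_le hφ hC h _ x).trans (mul_le_mul_right (ih x) c)

/-- Two copies of the iteration driven by the same noise. -/
def coupledStep (φ : X → Z → X) (x : X × X) (z : Z) : X × X := (φ x.1 z, φ x.2 z)

/-- Inclusion–exclusion: the two survival events, realised on the same noise, have a union of
probability at most 1. -/
lemma survival_add_survival_le [IsProbabilityMeasure D] (hφ : Measurable (Function.uncurry φ))
    (hC : MeasurableSet C) (n : ℕ) (u v : X) :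
    survival D φ C n u + survival D φ C n v
      ≤ 1 + survival D (coupledStep φ) (C ×ˢ C) n (u, v) := by
  induction n generalizing u v with
  | zero =>
    by_cases hu : u ∈ C <;> by_cases hv : v ∈ C <;> simp [survival, hu, hv]
  | succ n ih =>
    by_cases hu : u ∈ C
    · by_cases hv : v ∈ C
      · have huv : (u, v) ∈ C ×ˢ C := ⟨hu, hv⟩
        rw [survival_succ_of_mem hu, survival_succ_of_mem hv, survival_succ_of_mem huv,
          ← lintegral_add_left (measurable_survival_step hφ hC n u)]
        calc _ ≤ ∫⁻ z, (1 + survival D (coupledStep φ) (C ×ˢ C) n (coupledStep φ (u, v) z)) ∂D :=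
              lintegral_mono fun z => ih _ _
          _ = _ := by rw [lintegral_add_left measurable_const]; simp
      · rw [survival_of_notMem hv, add_zero]
        exact (survival_le_one _ _).trans le_self_add
    · rw [survival_of_notMem hu, zero_add]
      exact (survival_le_one _ _).trans le_self_add

lemma lintegral_comp_of_indepFun {Ω Y : Type*} [MeasurableSpace Ω] [MeasurableSpace Y]
    {P : Measure Ω} [IsProbabilityMeasure P] {V : Ω → Y} {W : Ω → Z} (hV : Measurable V)
    (hW : Measurable W) (h : IndepFun V W P) {G : Y × Z → ℝ≥0∞} (hG : Measurable G) :
    ∫⁻ ω, G (V ω, W ω) ∂P = ∫⁻ ω, ∫⁻ z, G (V ω, z) ∂(P.map W) ∂P := by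
  have : IsProbabilityMeasure (P.map W) := Measure.isProbabilityMeasure_map hW.aemeasurable
  rw [← lintegral_map (f := G) hG (hV.prodMk hW),
    (indepFun_iff_map_prod_eq_prod_map_map hV.aemeasurable hW.aemeasurable).1 h,
    lintegral_prod _ hG.aemeasurable, lintegral_map hG.lintegral_prod_right' hV]

/-- The `σ`-algebra generated by `ζ 0, …, ζ (k - 1)`. -/
@[reducible]
def past {Ω : Type*} (ζ : ℕ → Ω → Z) (k : ℕ) : MeasurableSpace Ω :=
  ⨆ j ∈ Set.Iio k, MeasurableSpace.comap (ζ j) inferInstance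

lemma past_le {Ω : Type*} {mΩ : MeasurableSpace Ω} {ζ : ℕ → Ω → Z} (hζ : ∀ k, Measurable (ζ k))
    (k : ℕ) : past ζ k ≤ mΩ :=
  iSup₂_le fun i _ => (hζ i).comap_le

lemma indepFun_of_measurable_past {Ω Y : Type*} {mΩ : MeasurableSpace Ω} [MeasurableSpace Y]
    {P : Measure Ω} {ζ : ℕ → Ω → Z} (hζ : ∀ k, Measurable (ζ k)) (hind : iIndepFun ζ P) {k : ℕ}
    {V : Ω → Y} (hV : Measurable[past ζ k] V) : IndepFun V (ζ k) P := by
  have h := indep_iSup_of_disjoint (fun i => (hζ i).comap_le) hind.iIndep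
    (S := Set.Iio k) (T := {k}) (by simp)
  rw [IndepFun_iff_Indep]
  refine indep_of_indep_of_le_left (indep_of_indep_of_le_right h ?_) hV.comap_le
  simp

lemma measurable_past_iterate {Ω : Type*} {ζ : ℕ → Ω → Z} {x : ℕ → Ω → X}
    (hφ : Measurable (Function.uncurry φ)) {x₀ : X}
    (h0 : ∀ ω, x 0 ω = x₀) (hx : ∀ k ω, x (k + 1) ω = φ (x k ω) (ζ k ω)) {i k : ℕ} (hik : i ≤ k) :
    Measurable[past ζ k] (x i) := by
  induction i with
  | zero =>
    rw [show x 0 = fun _ => x₀ from funext h0]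
    exact measurable_const
  | succ i ih =>
    rw [show x (i + 1) = fun ω => Function.uncurry φ (x i ω, ζ i ω) from funext (hx i)]
    have hζ : Measurable[past ζ k] (ζ i) :=
      (comap_measurable (ζ i)).mono
        (le_iSup₂_of_le (f := fun j (_ : j ∈ Set.Iio k) =>
          MeasurableSpace.comap (ζ j) inferInstance) i (by simpa using hik) le_rfl) le_rfl
    exact hφ.comp ((ih (by omega)).prodMk hζ)

variable {Ω : Type*} [MeasurableSpace Ω] {P : Measure Ω} {ζ : ℕ → Ω → Z} {x : ℕ → Ω → X}

/-- Future samples are integrated out one at a time: `ζ j` is independent of the iterates up to time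
`j`, so averaging over it turns survival for `n` steps into survival for `n + 1`. -/
lemma lintegral_prod_survival [IsProbabilityMeasure D] [IsProbabilityMeasure P]
    (hφ : Measurable (Function.uncurry φ)) (hC : MeasurableSet C)
    (hζ : ∀ k, Measurable (ζ k)) (hlaw : ∀ k, P.map (ζ k) = D) (hind : iIndepFun ζ P) {x₀ : X}
    (h0 : ∀ ω, x 0 ω = x₀) (hx : ∀ k ω, x (k + 1) ω = φ (x k ω) (ζ k ω)) (n j : ℕ) :
    ∫⁻ ω, ∏ i ∈ Finset.range (j + n + 1), C.indicator (1 : X → ℝ≥0∞) (x i ω) ∂P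
      = ∫⁻ ω, (∏ i ∈ Finset.range j, C.indicator (1 : X → ℝ≥0∞) (x i ω))
          * survival D φ C n (x j ω) ∂P := by
  induction n generalizing j with
  | zero => simp only [add_zero, Finset.prod_range_succ, survival]
  | succ n ih =>
    rw [show j + (n + 1) + 1 = (j + 1) + n + 1 by ring, ih]
    set w : Ω → ℝ≥0∞ := fun ω => ∏ i ∈ Finset.range (j + 1), C.indicator (1 : X → ℝ≥0∞) (x i ω)
    have hw : Measurable[past ζ j] w :=
      Finset.measurable_fun_prod _ fun i hi => (measurable_one.indicator hC).comp
        (measurable_past_iterate hφ h0 hx (by simpa [Nat.lt_succ_iff] using hi))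
    have hV : Measurable[past ζ j] fun ω => (w ω, x j ω) :=
      hw.prodMk (measurable_past_iterate hφ h0 hx le_rfl)
    have hS := measurable_survival (D := D) hφ hC n
    have hG : Measurable fun q : (ℝ≥0∞ × X) × Z => q.1.1 * survival D φ C n (φ q.1.2 q.2) :=
      (measurable_fst.comp measurable_fst).mul
        (hS.comp (hφ.comp ((measurable_snd.comp measurable_fst).prodMk measurable_snd)))
    have key := lintegral_comp_of_indepFun (hV.mono (past_le hζ j) le_rfl) (hζ j)
      (indepFun_of_measurable_past hζ hind hV) hG
    simp only [hlaw, ← hx] at key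
    rw [key]
    refine lintegral_congr fun ω => ?_
    rw [lintegral_const_mul _ (measurable_survival_step hφ hC n _)]
    simp only [w, Finset.prod_range_succ, survival, mul_assoc]
    congr 1
    by_cases h : x j ω ∈ C <;> simp [h]

/-- The survival function is the probability that an iteration with independent noise stays
in `C`. -/
lemma measure_forall_mem_le_survival [IsProbabilityMeasure D] [IsProbabilityMeasure P]
    (hφ : Measurable (Function.uncurry φ)) (hC : MeasurableSet C)
    (hζ : ∀ k, Measurable (ζ k)) (hlaw : ∀ k, P.map (ζ k) = D) (hind : iIndepFun ζ P) {x₀ : X}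
    (h0 : ∀ ω, x 0 ω = x₀) (hx : ∀ k ω, x (k + 1) ω = φ (x k ω) (ζ k ω)) (n : ℕ) :
    P {ω | ∀ k ≤ n, x k ω ∈ C} ≤ survival D φ C n x₀ := by
  have h := lintegral_prod_survival hφ hC hζ hlaw hind h0 hx n 0
  simp only [zero_add, Finset.range_zero, Finset.prod_empty, one_mul, h0, lintegral_const,
    measure_univ, mul_one] at h
  rw [← h]
  calc P {ω | ∀ k ≤ n, x k ω ∈ C}
      ≤ P {ω | 1 ≤ ∏ i ∈ Finset.range (n + 1), C.indicator (1 : X → ℝ≥0∞) (x i ω)} := by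
        refine measure_mono fun ω hω => ?_
        have h1 : ∏ i ∈ Finset.range (n + 1), C.indicator (1 : X → ℝ≥0∞) (x i ω) = 1 :=
          Finset.prod_eq_one fun i hi => by
            simp [hω i (by simpa [Nat.lt_succ_iff] using hi)]
        exact h1.ge
    _ ≤ _ := by
        refine (meas_ge_le_lintegral_div ?_ one_ne_zero ENNReal.one_ne_top).trans (by simp)
        exact (Finset.measurable_fun_prod (Finset.range (n + 1)) fun i _ =>
          (measurable_one.indicator hC).comp
            ((measurable_past_iterate hφ h0 hx (le_refl i)).mono (past_le hζ i) le_rfl)).aemeasurable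

end Survival

/-! ### Stochastic gradients and differentiation under the expectation -/

section Gradient

open InnerProductSpace Filter Topology

variable {d : ℕ} {Z : Type*} [MeasurableSpace Z] {D : Measure Z} {F : E d → Z → ℝ} {L ρ : ℝ}

lemma IsStochasticObjective.hasGradientAt (hF : IsStochasticObjective F D) (x : E d) (z : Z) :
    HasGradientAt (fun y => F y z) (stochGrad F x z) x :=
  (hF.differentiable z x).hasGradientAt

/-- Each coordinate is a pointwise limit of difference quotients, which are measurable in `z`. -/
lemma IsStochasticObjective.measurable_stochGrad (hF : IsStochasticObjective F D) (x : E d) :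
    Measurable (stochGrad F x) := by
  have hcoord : ∀ v : E d, Measurable fun z => inner ℝ v (stochGrad F x z) := by
    intro v
    refine measurable_of_tendsto_metrizable (f := fun (n : ℕ) z =>
      (n + 1 : ℝ) * (F (x + (n + 1 : ℝ)⁻¹ • v) z - F x z)) (fun n => ?_) ?_
    · exact ((hF.measurable _).sub (hF.measurable _)).const_mul _
    · rw [tendsto_pi_nhds]
      intro z
      have h := (hF.hasGradientAt x z).hasFDerivAt
      have h2 := (h.lim_real v).comp
        (tendsto_atTop_add_const_right atTop (1 : ℝ) tendsto_natCast_atTop_atTop)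
      rw [toDual_apply_apply, real_inner_comm] at h2
      exact h2
  have hsum : stochGrad F x = fun z => ∑ i, inner ℝ (stdOrthonormalBasis ℝ (E d) i)
      (stochGrad F x z) • stdOrthonormalBasis ℝ (E d) i :=
    funext fun z => ((stdOrthonormalBasis ℝ (E d)).sum_repr' _).symm
  rw [hsum]
  exact Finset.measurable_sum _ fun i _ => (hcoord _).smul_const _

lemma Smoothness.continuous_stochGrad (hs : Smoothness F D L ρ) (z : Z) :
    Continuous fun x => stochGrad F x z := by
  refine (LipschitzWith.of_dist_le_mul (K := L.toNNReal) fun x y => ?_).continuous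
  rw [dist_eq_norm, dist_eq_norm]
  refine (hs.grad_lipschitz z x y).trans ?_
  gcongr
  exact Real.le_coe_toNNReal L

lemma measurable_uncurry_stochGrad (hF : IsStochasticObjective F D) (hs : Smoothness F D L ρ) :
    Measurable (Function.uncurry (stochGrad F)) :=
  measurable_uncurry_of_continuous_of_measurable hs.continuous_stochGrad
    hF.measurable_stochGrad

lemma norm_le_sum_abs_inner (x : E d) :
    ‖x‖ ≤ ∑ i, |inner ℝ (stdOrthonormalBasis ℝ (E d) i) x| := by
  conv_lhs => rw [← (stdOrthonormalBasis ℝ (E d)).sum_repr' x]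
  refine (norm_sum_le _ _).trans (Finset.sum_le_sum fun i _ => ?_)
  simp [norm_smul]

lemma abs_sub_sub_inner_le (hF : IsStochasticObjective F D) (hs : Smoothness F D L ρ) (hL : 0 ≤ L)
    (x h : E d) (z : Z) :
    |F (x + h) z - F x z - inner ℝ (stochGrad F x z) h| ≤ L * ‖h‖ * ‖h‖ := by
  have key := (convex_closedBall x ‖h‖).norm_image_sub_le_of_norm_hasFDerivWithin_le'
    (f := fun y => F y z) (f' := fun y => toDual ℝ (E d) (stochGrad F y z))
    (φ := toDual ℝ (E d) (stochGrad F x z)) (C := L * ‖h‖) (x := x) (y := x + h)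
    (fun y _ => (hF.hasGradientAt y z).hasFDerivAt.hasFDerivWithinAt) (fun y hy => ?_)
    (by simp) (by simp)
  · simpa using key
  · rw [← map_sub, LinearIsometryEquiv.norm_map]
    refine (hs.grad_lipschitz z y x).trans ?_
    gcongr
    simpa [dist_eq_norm] using hy

/-- The Taylor remainder is bounded uniformly in `z`, so a directional derivative differs from the
integrable increment of `F` by a bounded function. -/
lemma integrable_stochGrad [IsProbabilityMeasure D] (hF : IsStochasticObjective F D)
    (hs : Smoothness F D L ρ) (hL : 0 ≤ L) (x : E d) : Integrable (stochGrad F x) D := by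
  have hi : ∀ v : E d, Integrable (fun z => inner ℝ v (stochGrad F x z)) D := by
    intro v
    have h1 : Integrable (fun z => F (x + v) z - F x z) D := (hF.integrable _).sub (hF.integrable _)
    have h2 : Integrable (fun z => F (x + v) z - F x z - inner ℝ (stochGrad F x z) v) D := by
      refine Integrable.of_bound (C := L * ‖v‖ * ‖v‖) ?_
        (ae_of_all _ fun z => abs_sub_sub_inner_le hF hs hL x v z)
      exact ((((hF.measurable _).sub (hF.measurable _))).sub
        ((hF.measurable_stochGrad x).inner_const)).aestronglyMeasurable
    refine (h1.sub h2).congr (ae_of_all _ fun z => ?_)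
    simp [real_inner_comm]
  refine Integrable.mono' (integrable_finsetSum Finset.univ fun i _ =>
    (hi (stdOrthonormalBasis ℝ (E d) i)).abs) (hF.measurable_stochGrad x).aestronglyMeasurable
    (ae_of_all _ fun z => norm_le_sum_abs_inner _)

/-- Differentiation under the expectation. -/
lemma gradient_objective [IsProbabilityMeasure D] (hF : IsStochasticObjective F D)
    (hs : Smoothness F D L ρ) (hL : 0 ≤ L) (x : E d) :
    gradient (objective F D) x = ∫ z, stochGrad F x z ∂D := by
  have hi := integrable_stochGrad hF hs hL
  refine HasGradientAt.gradient ?_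
  rw [hasGradientAt_iff_isLittleO_nhds_zero]
  -- The quadratic remainder bound is uniform in `z` and so survives integration.
  have hO : (fun h : E d => objective F D (x + h) - objective F D x
      - inner ℝ (∫ z, stochGrad F x z ∂D) h) =O[𝓝 0] fun h => ‖h‖ ^ 2 := by
    refine Asymptotics.IsBigO.of_bound L (Eventually.of_forall fun h => ?_)
    have h1 : objective F D (x + h) - objective F D x - inner ℝ (∫ z, stochGrad F x z ∂D) h
        = ∫ z, (F (x + h) z - F x z - inner ℝ (stochGrad F x z) h) ∂D := by
      have h2 : ∫ z, inner ℝ (stochGrad F x z) h ∂D = inner ℝ (∫ z, stochGrad F x z ∂D) h := by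
        simp_rw [real_inner_comm h]
        exact integral_inner (hi x) h
      have h3 : Integrable (fun z => F (x + h) z - F x z) D :=
        (hF.integrable _).sub (hF.integrable _)
      rw [integral_sub h3 ((hi x).inner_const h),
        integral_sub (hF.integrable _) (hF.integrable _), h2]
      rfl
    rw [h1]
    refine (norm_integral_le_of_norm_le_const (ae_of_all _ fun z =>
      abs_sub_sub_inner_le hF hs hL x h z)).trans ?_
    simp [pow_two, mul_assoc]
  exact hO.trans_isLittleO (Asymptotics.isLittleO_norm_pow_id one_lt_two)

lemma norm_gradient_sub_le [IsProbabilityMeasure D] (hF : IsStochasticObjective F D)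
    (hs : Smoothness F D L ρ) (hL : 0 ≤ L) (x y : E d) :
    ‖gradient (objective F D) x - gradient (objective F D) y‖ ≤ L * ‖x - y‖ := by
  have hi := integrable_stochGrad hF hs hL
  rw [gradient_objective hF hs hL, gradient_objective hF hs hL, ← integral_sub (hi x) (hi y)]
  refine (norm_integral_le_of_norm_le_const (ae_of_all _ fun z =>
    hs.grad_lipschitz z x y)).trans ?_
  simp

end Gradient

/-! ### The Hessian: symmetry and linearisation error -/

section Hessian

open InnerProductSpace

variable {d : ℕ} {f : E d → ℝ}

lemma hasFDerivAt_gradient (hf : ContDiff ℝ 2 f) (x : E d) :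
    HasFDerivAt (gradient f) (hessian f x) x := by
  have h1 : Differentiable ℝ (fderiv ℝ f) :=
    (hf.fderiv_right (m := 1) (by norm_num)).differentiable (by norm_num)
  have h2 : Differentiable ℝ (gradient f) :=
    ((toDual ℝ (E d)).symm.toContinuousLinearEquiv.differentiable).comp h1
  exact (h2 x).hasFDerivAt

lemma inner_hessian (hf : ContDiff ℝ 2 f) (x v w : E d) :
    inner ℝ (hessian f x v) w = fderiv ℝ (fderiv ℝ f) x v w := by
  have h1 : HasFDerivAt (fun y => innerSL ℝ w (gradient f y))
      ((innerSL ℝ w).comp (hessian f x)) x :=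
    (innerSL ℝ w).hasFDerivAt.comp x (hasFDerivAt_gradient hf x)
  have h2 : (fun y => innerSL ℝ w (gradient f y)) = fun y => fderiv ℝ f y w := by
    funext y
    rw [innerSL_apply_apply, real_inner_comm, inner_gradient_left]
  have h3 : DifferentiableAt ℝ (fderiv ℝ f) x :=
    (hf.fderiv_right (m := 1) (by norm_num)).differentiable (by norm_num) x
  rw [h2] at h1
  have h4 := h1.unique (h3.hasFDerivAt.clm_apply (hasFDerivAt_const w x))
  have h5 := congrArg (fun T : E d →L[ℝ] ℝ => T v) h4
  simpa [real_inner_comm] using h5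

lemma isSymmetric_hessian (hf : ContDiff ℝ 2 f) (x : E d) :
    (hessian f x : E d →ₗ[ℝ] E d).IsSymmetric := by
  intro v w
  have h : IsSymmSndFDerivAt ℝ f x := hf.contDiffAt.isSymmSndFDerivAt (by simp)
  change inner ℝ (hessian f x v) w = inner ℝ v (hessian f x w)
  rw [inner_hessian hf, h.eq, ← inner_hessian hf, real_inner_comm]

lemma norm_gradient_sub_sub_hessian_le (hf : ContDiff ℝ 2 f) {ρ : ℝ} (hρ : 0 ≤ ρ)
    (h : ∀ x x', ‖hessian f x - hessian f x'‖ ≤ ρ * ‖x - x'‖) {x₀ u v : E d} {B : ℝ}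
    (hu : u ∈ Metric.closedBall x₀ B) (hv : v ∈ Metric.closedBall x₀ B) :
    ‖gradient f v - gradient f u - hessian f x₀ (v - u)‖ ≤ ρ * B * ‖v - u‖ := by
  refine (convex_closedBall x₀ B).norm_image_sub_le_of_norm_hasFDerivWithin_le'
    (fun y _ => (hasFDerivAt_gradient hf y).hasFDerivWithinAt) (fun y hy => ?_) hu hv
  refine (h y x₀).trans ?_
  gcongr
  simpa [dist_eq_norm] using hy

end Hessian

/-! ### The least eigenvalue and the expansion rate -/

section Spectrum

variable {d : ℕ} {A : E d →L[ℝ] E d}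

lemma finite_eigenvalues (A : E d →L[ℝ] E d) :
    {μ : ℝ | Module.End.HasEigenvalue (A : E d →ₗ[ℝ] E d) μ}.Finite :=
  Module.End.finite_hasEigenvalue _

lemma exists_eigenvector_lambdaMin (h : lambdaMin A < 0) :
    ∃ v : E d, ‖v‖ = 1 ∧ A v = lambdaMin A • v := by
  -- Negativity excludes an empty spectrum, for which `sInf` takes the default value 0.
  have hne : {μ : ℝ | Module.End.HasEigenvalue (A : E d →ₗ[ℝ] E d) μ}.Nonempty := by
    by_contra hne
    rw [Set.not_nonempty_iff_eq_empty] at hne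
    simp [lambdaMin, hne] at h
  obtain ⟨v, hv⟩ := (hne.csInf_mem (finite_eigenvalues A)).exists_hasEigenvector
  have hv0 : ‖v‖ ≠ 0 := norm_ne_zero_iff.2 hv.2
  refine ⟨‖v‖⁻¹ • v, by simp [norm_smul, hv0], ?_⟩
  have h1 : A v = lambdaMin A • v := hv.apply_eq_smul
  rw [map_smul, h1, smul_comm]

/-- A gradient step on the quadratic form of `A` expands distances at most by the
factor `1 - η λ_min(A)`. -/
lemma norm_sub_smul_apply_le (hA : (A : E d →ₗ[ℝ] E d).IsSymmetric) {L η : ℝ} (hL : ‖A‖ ≤ L)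
    (hη : 0 ≤ η) (hηL : η * L ≤ 1) (hneg : lambdaMin A ≤ 0) (x : E d) :
    ‖x - η • A x‖ ≤ (1 - η * lambdaMin A) * ‖x‖ := by
  have hn : Module.finrank ℝ (E d) = d := finrank_euclideanSpace_fin
  set b := hA.eigenvectorBasis hn
  have hg : 0 ≤ 1 - η * lambdaMin A := by nlinarith
  have hcoord : ∀ i, |b.repr (x - η • A x) i| ≤ (1 - η * lambdaMin A) * |b.repr x i| := by
    intro i
    have h1 : b.repr (x - η • A x) i = (1 - η * hA.eigenvalues hn i) * b.repr x i := by
      have := hA.eigenvectorBasis_apply_self_apply hn x i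
      change b.repr (A x) i = _ at this
      simp only [map_sub, map_smul, PiLp.sub_apply, PiLp.smul_apply, this, smul_eq_mul]
      change _ - η * (hA.eigenvalues hn i * b.repr x i) = _
      ring
    rw [h1, abs_mul]
    have hev := hA.hasEigenvalue_eigenvalues hn i
    have hle : lambdaMin A ≤ hA.eigenvalues hn i := csInf_le (finite_eigenvalues A).bddBelow hev
    have hge : hA.eigenvalues hn i ≤ L := by
      have h2 : A (b i) = hA.eigenvalues hn i • b i := hA.apply_eigenvectorBasis hn i
      have h3 := (A.le_opNorm (b i)).trans (mul_le_mul_of_nonneg_right hL (norm_nonneg _))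
      rw [h2, norm_smul, b.norm_eq_one, mul_one, mul_one] at h3
      exact (le_abs_self _).trans h3
    gcongr
    -- Every eigenvalue is at most `L` and `ηL ≤ 1`, so the factor is nonnegative and is largest at
    -- the least eigenvalue.
    rw [abs_of_nonneg (by nlinarith)]
    nlinarith
  refine le_of_sq_le_sq ?_ (by positivity)
  rw [mul_pow, ← b.repr.norm_map (x - _), ← b.repr.norm_map x, EuclideanSpace.norm_sq_eq,
    EuclideanSpace.norm_sq_eq, Finset.mul_sum]
  refine Finset.sum_le_sum fun i _ => ?_
  rw [← mul_pow]
  exact pow_le_pow_left₀ (norm_nonneg _) (hcoord i) 2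

lemma norm_hessian_le {f : E d → ℝ} {L : ℝ} (hL : 0 ≤ L)
    (hf : ∀ x y, ‖gradient f x - gradient f y‖ ≤ L * ‖x - y‖) (x : E d) : ‖hessian f x‖ ≤ L :=
  norm_fderiv_le_of_lipschitz ℝ (C := ⟨L, hL⟩)
    (LipschitzWith.of_dist_le_mul fun x y => by
      rw [dist_eq_norm, dist_eq_norm]; exact hf x y)

end Spectrum

/-! ### Coupled iterations near the saddle and dispersive noise -/

section Coupling

variable {d : ℕ} {Z : Type*} [MeasurableSpace Z] {D : Measure Z} [IsProbabilityMeasure D]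
  {F : E d → Z → ℝ} {L ρ η B g : ℝ} {x₀ v : E d}

/-- Bias plus variance, with the variance bounded by the second moment. -/
lemma integral_norm_sub_sq_le {X : Z → E d} (hX : Integrable X D) {R : ℝ}
    (hR : ∀ z, ‖X z‖ ≤ R) (c : E d) :
    ∫ z, ‖c - X z‖ ^ 2 ∂D ≤ ‖c - ∫ z, X z ∂D‖ ^ 2 + R ^ 2 := by
  have hi : Integrable (fun z => ‖c‖ ^ 2 - 2 * inner ℝ c (X z) + R ^ 2) D :=
    ((integrable_const _).sub ((hX.const_inner c).const_mul 2)).add (integrable_const _)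
  calc ∫ z, ‖c - X z‖ ^ 2 ∂D ≤ ∫ z, (‖c‖ ^ 2 - 2 * inner ℝ c (X z) + R ^ 2) ∂D := by
        refine integral_mono_of_nonneg (ae_of_all _ fun z => by positivity) hi
          (ae_of_all _ fun z => ?_)
        simp only [norm_sub_sq_real]
        gcongr
        exact hR z
    _ = ‖c‖ ^ 2 - 2 * inner ℝ c (∫ z, X z ∂D) + R ^ 2 := by
        have h1 : Integrable (fun z => 2 * inner ℝ c (X z)) D := (hX.const_inner c).const_mul 2
        have h2 : Integrable (fun z => ‖c‖ ^ 2 - 2 * inner ℝ c (X z)) D :=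
          (integrable_const _).sub h1
        rw [integral_add h2 (integrable_const _), integral_sub (integrable_const _) h1,
          integral_const_mul, integral_inner hX]
        simp
    _ ≤ _ := by
        rw [norm_sub_sq_real]
        nlinarith [sq_nonneg ‖∫ z, X z ∂D‖]

/-- One step of stochastic gradient descent. -/
noncomputable def sgdStep (F : E d → Z → ℝ) (η : ℝ) (x : E d) (z : Z) : E d :=
  x - η • stochGrad F x z

omit [IsProbabilityMeasure D] in
lemma measurable_sgdStep (hF : IsStochasticObjective F D) (hs : Smoothness F D L ρ) :
    Measurable (Function.uncurry (sgdStep F η)) :=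
  measurable_fst.sub ((measurable_uncurry_stochGrad hF hs).const_smul η)

/-- Second moment of the relative deviation of the coupled difference from the
direction `v` after one step. -/
lemma integral_norm_coupled_sub_sq_le (hF : IsStochasticObjective F D) (hs : Smoothness F D L ρ)
    (hL : 0 ≤ L) (hρ : 0 ≤ ρ) (hη : 0 ≤ η) (hg : 1 ≤ g) (hv : ‖v‖ = 1)
    (hHv : v - η • hessian (objective F D) x₀ v = g • v)
    (hH : ∀ x, ‖x - η • hessian (objective F D) x₀ x‖ ≤ g * ‖x‖) {u w : E d}
    (hu : u ∈ Metric.closedBall x₀ B) (hw : w ∈ Metric.closedBall x₀ B) {s : ℝ} (hs0 : 0 < s) :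
    Integrable (fun z => ‖(g * s)⁻¹ • (sgdStep F η w z - sgdStep F η u z) - v‖ ^ 2) D ∧
    ∫ z, ‖(g * s)⁻¹ • (sgdStep F η w z - sgdStep F η u z) - v‖ ^ 2 ∂D
      ≤ (‖s⁻¹ • (w - u) - v‖ + η * (ρ * B) * (‖s⁻¹ • (w - u) - v‖ + 1)) ^ 2
        + (η * L * (‖s⁻¹ • (w - u) - v‖ + 1)) ^ 2 := by
  have hg0 : 0 < g := by linarith
  have hB : 0 ≤ B := dist_nonneg.trans hu
  set H := hessian (objective F D) x₀
  set y := s⁻¹ • (w - u) - v with hy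
  have hΔ : w - u = s • (y + v) := by
    rw [hy, sub_add_cancel, smul_smul, mul_inv_cancel₀ hs0.ne', one_smul]
  have hyv : ‖y + v‖ ≤ ‖y‖ + 1 := hv ▸ norm_add_le y v
  set X : Z → E d := fun z => ((g * s)⁻¹ * η) • (stochGrad F w z - stochGrad F u z) with hX
  have hiw := integrable_stochGrad hF hs hL w
  have hiu := integrable_stochGrad hF hs hL u
  have hXi : Integrable X D := (hiw.sub hiu).smul ((g * s)⁻¹ * η)
  have hXb : ∀ z, ‖X z‖ ≤ η * L * (‖y‖ + 1) := by
    intro z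
    have h1 := hs.grad_lipschitz z w u
    rw [hΔ, norm_smul, Real.norm_of_nonneg hs0.le] at h1
    rw [hX, norm_smul, Real.norm_of_nonneg (by positivity)]
    calc (g * s)⁻¹ * η * ‖stochGrad F w z - stochGrad F u z‖
        ≤ (g * s)⁻¹ * η * (L * (s * (‖y‖ + 1))) := by
          gcongr
          exact h1.trans (by gcongr)
      _ = g⁻¹ * (η * L * (‖y‖ + 1)) := by field_simp
      _ ≤ 1 * (η * L * (‖y‖ + 1)) := by
          gcongr
          exact inv_le_one_of_one_le₀ hg
      _ = _ := one_mul _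
  have heq : ∀ z, (g * s)⁻¹ • (sgdStep F η w z - sgdStep F η u z) - v
      = ((g * s)⁻¹ • (w - u) - v) - X z := by
    intro z
    simp only [hX, sgdStep]
    module
  simp only [heq]
  refine ⟨?_, ?_⟩
  · refine Integrable.of_bound (C := (‖(g * s)⁻¹ • (w - u) - v‖ + η * L * (‖y‖ + 1)) ^ 2)
      ((aestronglyMeasurable_const.sub hXi.aestronglyMeasurable).norm.pow 2)
      (ae_of_all _ fun z => ?_)
    rw [Real.norm_of_nonneg (by positivity)]
    gcongr
    exact (norm_sub_le _ _).trans (by gcongr; exact hXb z)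
  · refine (integral_norm_sub_sq_le hXi hXb _).trans ?_
    gcongr
    have hmean : ∫ z, X z ∂D
        = ((g * s)⁻¹ * η) • (gradient (objective F D) w - gradient (objective F D) u) := by
      rw [hX, integral_smul, integral_sub hiw hiu, gradient_objective hF hs hL,
        gradient_objective hF hs hL]
    set R := gradient (objective F D) w - gradient (objective F D) u - H (w - u) with hR
    have hRb : ‖R‖ ≤ ρ * B * ‖w - u‖ :=
      norm_gradient_sub_sub_hessian_le hs.contDiff hρ hs.hessian_lipschitz hu hw
    -- As `1 - ηH` multiplies `v` by `g`, dividing by `g` fixes `v`: only the deviation `y` is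
    -- transported, plus the linearisation error `R`.
    have hdec : (g * s)⁻¹ • (w - u) - v - ∫ z, X z ∂D
        = g⁻¹ • (y - η • H y) - ((g * s)⁻¹ * η) • R := by
      have h1 : gradient (objective F D) w - gradient (objective F D) u = R + H (w - u) := by
        rw [hR]; abel
      have h2 : g⁻¹ • (v - η • H v) = v := by rw [hHv, smul_smul, inv_mul_cancel₀ hg0.ne', one_smul]
      rw [hmean, h1, hΔ, map_smul, map_add]
      nth_rewrite 2 [← h2]
      rw [mul_inv]
      have h3 : s⁻¹ * s = 1 := inv_mul_cancel₀ hs0.ne'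
      simp only [smul_add, smul_sub, smul_smul]
      rw [show g⁻¹ * s⁻¹ * s = g⁻¹ by rw [mul_assoc, h3, mul_one],
        show g⁻¹ * s⁻¹ * η * s = g⁻¹ * η by rw [← mul_one (g⁻¹ * η), ← h3]; ring]
      abel
    rw [hdec]
    refine (norm_sub_le _ _).trans (add_le_add ?_ ?_)
    · rw [norm_smul, Real.norm_of_nonneg (by positivity), inv_mul_le_iff₀ hg0]
      exact hH y
    · rw [hΔ, norm_smul, Real.norm_of_nonneg hs0.le] at hRb
      rw [norm_smul, Real.norm_of_nonneg (by positivity)]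
      calc (g * s)⁻¹ * η * ‖R‖ ≤ (g * s)⁻¹ * η * (ρ * B * (s * (‖y‖ + 1))) := by
            gcongr
            exact hRb.trans (by gcongr)
        _ = g⁻¹ * (η * (ρ * B) * (‖y‖ + 1)) := by field_simp
        _ ≤ 1 * (η * (ρ * B) * (‖y‖ + 1)) := by
            gcongr
            exact inv_le_one_of_one_le₀ hg
        _ = _ := one_mul _

/-- Two iterations driven by the same noise are unlikely to stay both in a small ball. -/
lemma survival_coupled_le (hF : IsStochasticObjective F D) (hs : Smoothness F D L ρ)
    (hL : 0 ≤ L) (hρ : 0 ≤ ρ) (hη : 0 ≤ η) (hg : 1 ≤ g) (hv : ‖v‖ = 1)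
    (hHv : v - η • hessian (objective F D) x₀ v = g • v)
    (hH : ∀ x, ‖x - η • hessian (objective F D) x₀ x‖ ≤ g * ‖x‖) {a b : ℝ} (ha : 0 ≤ a)
    (hb : 0 ≤ b) (hab : ∀ t, 0 ≤ t →
      (t + η * (ρ * B) * (t + 1)) ^ 2 + (η * L * (t + 1)) ^ 2 ≤ (1 + a) * t ^ 2 + b)
    (n : ℕ) (u w : E d) {s : ℝ} (hs0 : 0 < s) (hn : 4 * B < g ^ n * s) :
    survival D (coupledStep (sgdStep F η)) (Metric.closedBall x₀ B ×ˢ Metric.closedBall x₀ B) n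
      (u, w) ≤ ENNReal.ofReal
        (4 * ((1 + a) ^ n * ‖s⁻¹ • (w - u) - v‖ ^ 2 + n * b * (1 + a) ^ n)) := by
  induction n generalizing u w s with
  | zero =>
    by_cases h : (u, w) ∈ Metric.closedBall x₀ B ×ˢ Metric.closedBall x₀ B
    · refine (survival_le_one 0 _).trans (ENNReal.one_le_ofReal.2 ?_)
      have h1 : ‖w - u‖ ≤ 2 * B := by
        rw [← dist_eq_norm]
        have := dist_triangle_right w u x₀
        have hu : dist u x₀ ≤ B := h.1
        have hw : dist w x₀ ≤ B := h.2
        linarith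
      have h2 : ‖s⁻¹ • (w - u)‖ ≤ 1 / 2 := by
        rw [norm_smul, Real.norm_of_nonneg (by positivity), inv_mul_le_iff₀ hs0]
        linarith
      have h3 := norm_sub_norm_le v (s⁻¹ • (w - u))
      rw [norm_sub_rev] at h3
      have h4 : 1 / 2 ≤ ‖s⁻¹ • (w - u) - v‖ := by linarith
      simp only [pow_zero, Nat.cast_zero]
      nlinarith
    · simp [survival_of_notMem h]
  | succ n ih =>
    by_cases h : (u, w) ∈ Metric.closedBall x₀ B ×ˢ Metric.closedBall x₀ B
    · obtain ⟨hint, hle⟩ := integral_norm_coupled_sub_sq_le hF hs hL hρ hη hg hv hHv hH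
        h.1 h.2 hs0
      have hgs : 0 < g * s := by positivity
      rw [survival_succ_of_mem h]
      -- The reference scale passes from `s` to `g * s`, which keeps `g ^ n * s` fixed along the
      -- induction.
      refine (lintegral_mono fun z => ih _ _ hgs (by rwa [← mul_assoc, ← pow_succ])).trans ?_
      dsimp only at hint hle ⊢
      have hi2 : Integrable (fun z => 4 * ((1 + a) ^ n
          * ‖(g * s)⁻¹ • (sgdStep F η w z - sgdStep F η u z) - v‖ ^ 2 + n * b * (1 + a) ^ n)) D :=
        ((hint.const_mul _).add (integrable_const _)).const_mul _
      rw [← ofReal_integral_eq_lintegral_ofReal hi2 (ae_of_all _ fun z => by positivity)]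
      refine ENNReal.ofReal_le_ofReal ?_
      rw [integral_const_mul, integral_add (hint.const_mul _) (integrable_const _),
        integral_const_mul, integral_const]
      simp only [probReal_univ, one_smul]
      set t := ‖s⁻¹ • (w - u) - v‖
      have h1 := hle.trans (hab t (norm_nonneg _))
      have hp : 0 < (1 + a) ^ n := by positivity
      calc _ ≤ 4 * ((1 + a) ^ n * ((1 + a) * t ^ 2 + b) + n * b * (1 + a) ^ n) := by gcongr
        _ = 4 * ((1 + a) ^ (n + 1) * t ^ 2 + (n + 1) * b * (1 + a) ^ n * 1) := by ring
        _ ≤ 4 * ((1 + a) ^ (n + 1) * t ^ 2 + (n + 1) * b * (1 + a) ^ n * (1 + a)) := by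
            gcongr
            linarith
        _ = _ := by push_cast; ring
    · simp [survival_of_notMem h]

/-- If two coupled iterations separated along `v` are unlikely to stay both in the ball, then
dispersive noise makes every iteration leave the ball with constant probability. -/
lemma survival_succ_le (hF : IsStochasticObjective F D) (hs : Smoothness F D L ρ)
    {σ : ℝ} (hη : 0 < η) (hdisp : DispersiveNoise F D σ)
    (hv : ‖v‖ = 1) (n : ℕ)
    (h : ∀ u : E d, ∀ q, η * (σ / (4 * √(d : ℝ))) ≤ q →
      survival D (coupledStep (sgdStep F η)) (Metric.closedBall x₀ B ×ˢ Metric.closedBall x₀ B) n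
        (u, u + q • v) ≤ ENNReal.ofReal (1 / 5)) (x : E d) :
    survival D (sgdStep F η) (Metric.closedBall x₀ B) (n + 1) x ≤ ENNReal.ofReal (7 / 10) := by
  set C := Metric.closedBall x₀ B
  set S := survival D (sgdStep F η) C n
  have hφ := measurable_sgdStep (η := η) hF hs
  have hC : MeasurableSet C := measurableSet_closedBall
  have hS : Measurable S := measurable_survival hφ hC n
  set A : Set (E d) := {y | ENNReal.ofReal (3 / 5) < S (x - η • y)} with hA
  have hAm : MeasurableSet A :=
    measurableSet_lt measurable_const (hS.comp (measurable_const.sub (measurable_id.const_smul η)))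
  have hnar : IsNarrow (σ / (4 * √(d : ℝ))) v A := by
    refine ⟨hAm, fun y hy r hr hy' => ?_⟩
    have h1 := survival_add_survival_le (D := D) hφ hC n (x - η • (y + r • v)) (x - η • y)
    -- Moving the gradient by `r • v` moves the next iterate by `ηr` along `v`, hence the factor `η`
    -- in the separation threshold.
    have h2 := h (x - η • (y + r • v)) (η * r) (by gcongr)
    rw [show x - η • (y + r • v) + (η * r) • v = x - η • y by module] at h2
    have h3 : ENNReal.ofReal (3 / 5) + ENNReal.ofReal (3 / 5) < 1 + ENNReal.ofReal (1 / 5) :=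
      (ENNReal.add_lt_add hy' hy).trans_le (h1.trans (by gcongr))
    rw [← ENNReal.ofReal_add (by norm_num) (by norm_num), ← ENNReal.ofReal_one,
      ← ENNReal.ofReal_add (by norm_num) (by norm_num)] at h3
    norm_num at h3
  have hDA : D {z | stochGrad F x z ∈ A} ≤ 1 / 4 := hdisp x v hv A hnar
  by_cases hx : x ∈ C
  · rw [survival_succ_of_mem hx]
    have hmeas : MeasurableSet {z | stochGrad F x z ∈ A} := hF.measurable_stochGrad x hAm
    calc ∫⁻ z, S (sgdStep F η x z) ∂D
        ≤ ∫⁻ z, (ENNReal.ofReal (3 / 5)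
          + {z | stochGrad F x z ∈ A}.indicator (fun _ => ENNReal.ofReal (2 / 5)) z) ∂D := by
          refine lintegral_mono fun z => ?_
          by_cases hz : stochGrad F x z ∈ A
          · simp only [Set.mem_ofPred_eq, hz, Set.indicator_of_mem]
            rw [← ENNReal.ofReal_add (by norm_num) (by norm_num)]
            norm_num
            exact survival_le_one _ _
          · simpa [hz] using not_lt.1 hz
      _ ≤ ENNReal.ofReal (3 / 5) + ENNReal.ofReal (2 / 5) * (1 / 4) := by
          rw [lintegral_add_left measurable_const, lintegral_indicator_const hmeas]
          simp only [lintegral_const, measure_univ, mul_one]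
          gcongr
      _ = ENNReal.ofReal (7 / 10) := by
          rw [show (1 / 4 : ℝ≥0∞) = ENNReal.ofReal (1 / 4) by
            rw [ENNReal.ofReal_div_of_pos (by norm_num)]; simp,
            ← ENNReal.ofReal_mul (by norm_num), ← ENNReal.ofReal_add (by norm_num) (by norm_num)]
          norm_num
  · simp [survival_of_notMem hx]

end Coupling

/-! ### Numerical consequences of the parameter setting -/

section Parameters

variable {d : ℕ} {L ρ σ ε p η : ℝ}

lemma two_le_rounds (hp : 0 < p) (hp1 : p < 1) : 2 ≤ rounds p := by
  have h0 : 0 < Real.log (1 / 0.7) := Real.log_pos (by norm_num)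
  have h1 : 1 ≤ Real.log (3 / p) / Real.log (1 / 0.7) := by
    rw [one_le_div h0]
    refine Real.log_le_log (by norm_num) ?_
    rw [le_div_iff₀ hp]
    norm_num
    linarith
  have h2 : 1 ≤ ⌊Real.log (3 / p) / Real.log (1 / 0.7)⌋₊ := Nat.le_floor (by exact_mod_cast h1)
  unfold rounds
  omega

lemma pow_rounds_le (hp : 0 < p) : (7 / 10 : ℝ) ^ rounds p ≤ p / 3 := by
  have h0 : 0 < Real.log (1 / 0.7) := Real.log_pos (by norm_num)
  have h1 : Real.log (3 / p) / Real.log (1 / 0.7) < rounds p := by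
    unfold rounds
    push_cast
    exact Nat.lt_floor_add_one _
  rw [div_lt_iff₀ h0, ← Real.log_pow] at h1
  have h2 := (Real.log_lt_log_iff (by positivity) (by positivity)).1 h1
  rw [show (7 / 10 : ℝ) = (1 / 0.7)⁻¹ by norm_num, inv_pow, inv_le_comm₀ (by positivity)
    (by positivity), inv_div]
  exact h2.le

/-- The numerical consequences of the parameter setting, with `ℓ = log (24 √d / η)`. -/
structure ParameterBounds (d N : ℕ) (L ρ σ η δ B ℓ : ℝ) : Prop where
  delta_pos : 0 < δ
  delta_le : δ ≤ 1
  radius_pos : 0 < B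
  rho_mul_radius : ρ * B * (2 * N * ℓ) = δ
  one_le_log : 1 ≤ ℓ
  exp_log : Real.exp ℓ = 24 * √(d : ℝ) / η
  eta_le : 192 * η * (2 * N * ℓ) ≤ B ^ 2 * δ
  radius_le : B ≤ 1
  mul_radius_le : L * B ≤ σ
  mul_radius_le_one : L * B ≤ 1

lemma ParameterSetting.bounds (h : ParameterSetting d L ρ σ ε p η) (hd : 0 < d) :
    ParameterBounds d (rounds p) L ρ σ η (delta ρ ε) (radius d ρ ε p η)
      (Real.log (24 * √(d : ℝ) / η)) := by
  have hη := h.eta_pos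
  have hρ := h.rho_pos
  have hL := h.L_pos
  have hd1 : (1 : ℝ) ≤ √(d : ℝ) := Real.one_le_sqrt.2 (by exact_mod_cast hd)
  have hδ : 0 < delta ρ ε := Real.sqrt_pos.2 (mul_pos h.rho_pos h.eps_pos)
  have hN : (2 : ℝ) ≤ rounds p := by exact_mod_cast two_le_rounds h.p_pos h.p_lt_one
  have hK := h.one_le_maxSteps
  have hCt : tildeC d p η = 2 * rounds p * Real.log (24 * √(d : ℝ) / η) := rfl
  have hKeq := maxSteps_eq d ρ ε p η
  have hx : 0 < η * deltaTwo ρ ε := by unfold deltaTwo; positivity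
  -- The sign of `log (24 √d / η)` is not known beforehand; `K₀ ≥ 1` makes `C̃₁` positive and,
  -- below, forces `η ≤ 1`.
  have hC16 : 16 * η * delta ρ ε ≤ tildeC d p η := by
    rw [hKeq, mul_assoc, ← mul_inv, ← div_eq_mul_inv, one_le_div hx] at hK
    unfold deltaTwo at hK
    linarith
  have hC : 0 < tildeC d p η := lt_of_lt_of_le (by positivity) hC16
  have hB : 0 < radius d ρ ε p η := div_pos hδ (by positivity)
  have hB1 : radius d ρ ε p η ≤ 1 := h.radius_le.trans (min_le_left _ _)
  have hBσ : radius d ρ ε p η ≤ σ / L := h.radius_le.trans ((min_le_right _ _).trans (min_le_left _ _))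
  have hBL : radius d ρ ε p η ≤ 1 / L :=
    h.radius_le.trans ((min_le_right _ _).trans (min_le_right _ _))
  rw [le_div_iff₀ hL, mul_comm] at hBσ hBL
  have hlog : 1 ≤ Real.log (48 * maxSteps d ρ ε p η / p) := by
    rw [Real.le_log_iff_exp_le (by have := h.p_pos; positivity), le_div_iff₀ h.p_pos]
    have := Real.exp_one_lt_three
    have := h.p_lt_one
    have := h.p_pos
    nlinarith
  -- 192 = 64 · 3: the maximum and the logarithm in the denominator are at least 1, and `3 + log K₀
  -- ≥ 3`.
  have hη192 : 192 * η * tildeC d p η ≤ radius d ρ ε p η ^ 2 * delta ρ ε := by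
    have h1 : η ≤ radius d ρ ε p η ^ 2 * delta ρ ε / (64 * 1 * tildeC d p η * 1) * (1 / 3) := by
      refine h.eta_le.trans ?_
      have := Real.log_nonneg hK
      gcongr
      · exact le_max_right _ _
      · linarith
    calc 192 * η * tildeC d p η ≤ 192 * (radius d ρ ε p η ^ 2 * delta ρ ε /
          (64 * 1 * tildeC d p η * 1) * (1 / 3)) * tildeC d p η := by gcongr
      _ = _ := by field_simp; norm_num
  have hη1 : η ≤ 1 := by
    have h1 : 192 * η * (16 * η * delta ρ ε) ≤ 1 * delta ρ ε := by
      calc _ ≤ 192 * η * tildeC d p η := by gcongr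
        _ ≤ radius d ρ ε p η ^ 2 * delta ρ ε := hη192
        _ ≤ _ := by gcongr; exact pow_le_one₀ hB.le hB1
    have h2 : 192 * η * (16 * η) ≤ 1 := le_of_mul_le_mul_right (by linarith) hδ
    nlinarith
  have hexp : (3 : ℝ) ≤ 24 * √(d : ℝ) / η := by
    rw [le_div_iff₀ hη]; nlinarith
  refine ⟨hδ, h.delta_le, hB, ?_, ?_, Real.exp_log (by linarith), hη192, hB1, hBσ, hBL⟩
  · rw [← hCt, radius]
    field_simp
  · rw [Real.le_log_iff_exp_le (by linarith)]
    exact Real.exp_one_lt_three.le.trans hexp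

variable {N n : ℕ} {δ B ℓ g : ℝ}

lemma ParameterBounds.eta_mul_le (h : ParameterBounds d N L ρ σ η δ B ℓ) (hη : 0 < η)
    (hN : 2 ≤ N) : η * ℓ ≤ δ / 768 := by
  have hN' : (2 : ℝ) ≤ N := by exact_mod_cast hN
  have hδ := h.delta_pos
  have h1 : 192 * η * (2 * 2 * ℓ) ≤ 1 * δ := by
    calc _ ≤ 192 * η * (2 * N * ℓ) := by have := h.one_le_log; gcongr
      _ ≤ B ^ 2 * δ := h.eta_le
      _ ≤ _ := by gcongr; exact pow_le_one₀ h.radius_pos.le h.radius_le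
  linarith

lemma ParameterBounds.eta_le_delta (h : ParameterBounds d N L ρ σ η δ B ℓ) (hη : 0 < η)
    (hN : 2 ≤ N) : η ≤ δ / 768 := by
  have := h.eta_mul_le hη hN
  have := h.one_le_log
  nlinarith

lemma ParameterBounds.le_roundLength (h : ParameterBounds d N L ρ σ η δ B ℓ) (hη : 0 < η)
    (hN : 2 ≤ N) : 96 ≤ 2 * ℓ / (16 * η * δ) := by
  have hδ := h.delta_pos
  rw [le_div_iff₀ (by positivity)]
  have := h.eta_le_delta hη hN
  have := h.one_le_log
  have := h.delta_le
  nlinarith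

/-- Over one round the accumulated drift `nβ` and noise `n(ηL)²` are small constants, so `(1 + a) ^
n` stays bounded and `n * b` stays small. -/
lemma ParameterBounds.deviation_le (h : ParameterBounds d N L ρ σ η δ B ℓ) (hη : 0 < η)
    (hL : 0 < L) (hρ : 0 < ρ) (hN : 2 ≤ N) (hn : n ≤ 2 * ℓ / (16 * η * δ)) {a b : ℝ}
    (ha : a = 4 * (η * (ρ * B)) + 2 * (η * (ρ * B)) ^ 2 + 2 * (η * L) ^ 2)
    (hb : b = (η * (ρ * B)) / 2 + 2 * (η * (ρ * B)) ^ 2 + 2 * (η * L) ^ 2) :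
    4 * (n * b * (1 + a) ^ n) ≤ 1 / 5 := by
  have hN' : (2 : ℝ) ≤ N := by exact_mod_cast hN
  have hδ := h.delta_pos
  have hB := h.radius_pos
  have hℓ : 0 < ℓ := lt_of_lt_of_le one_pos h.one_le_log
  have hK := h.le_roundLength hη hN
  set K := 2 * ℓ / (16 * η * δ) with hKdef
  set β := η * (ρ * B) with hβ
  have hβ0 : 0 < β := by positivity
  -- The radius is chosen for this: `ρB = δ / C̃₁` gives `Kβ = 1 / (16N)`, and `N ≥ 2`.
  have hKβ : K * β ≤ 1 / 32 := by
    have h1 : K * β = 1 / (16 * N) := by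
      have : ρ * B = δ / (2 * N * ℓ) := by
        rw [eq_div_iff (by positivity)]; exact h.rho_mul_radius
      rw [hKdef, hβ, this]
      field_simp
    rw [h1]
    exact one_div_le_one_div_of_le (by norm_num) (by linarith)
  have hKα : K * (η * L) ^ 2 ≤ 1 / 1000 := by
    have h1 : 192 * η * (2 * N * ℓ) * L ^ 2 ≤ δ := by
      calc _ ≤ B ^ 2 * δ * L ^ 2 := mul_le_mul_of_nonneg_right h.eta_le (by positivity)
        _ = (L * B) ^ 2 * δ := by ring
        _ ≤ 1 * δ := by
          gcongr
          exact pow_le_one₀ (by positivity) h.mul_radius_le_one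
        _ = δ := one_mul δ
    have h2 : K * (η * L) ^ 2 = ℓ * η * L ^ 2 / (8 * δ) := by
      rw [hKdef]; field_simp; norm_num
    rw [h2, div_le_iff₀ (by positivity)]
    have h3 : 192 * η * (2 * 2 * ℓ) * L ^ 2 ≤ 192 * η * (2 * N * ℓ) * L ^ 2 := by gcongr
    nlinarith
  have hβ1 : β ≤ 1 / 3000 := by nlinarith
  have hnβ : n * β ≤ 1 / 32 := (mul_le_mul_of_nonneg_right hn hβ0.le).trans hKβ
  have hnα : n * (η * L) ^ 2 ≤ 1 / 1000 :=
    (mul_le_mul_of_nonneg_right hn (by positivity)).trans hKα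
  have hnβ2 : n * β ^ 2 ≤ 1 / 1000 := by
    have h0 : (0 : ℝ) ≤ n * β := by positivity
    nlinarith
  have hnb : n * b ≤ 1 / 32 := by rw [hb]; linarith
  have hna : n * a ≤ 1 / 4 := by rw [ha]; linarith
  have ha0 : 0 ≤ a := by rw [ha]; positivity
  have hb0 : 0 ≤ b := by rw [hb]; positivity
  have hpow : (1 + a) ^ n ≤ 4 / 3 := by
    calc (1 + a) ^ n ≤ Real.exp a ^ n := by
          gcongr
          linarith [Real.add_one_le_exp a]
      _ = Real.exp (n * a) := (Real.exp_nat_mul a n).symm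
      _ ≤ Real.exp (1 / 4) := Real.exp_le_exp.2 hna
      _ ≤ 4 / 3 := by
          have h1 := Real.add_one_le_exp (-(1 / 4) : ℝ)
          have h2 : Real.exp (1 / 4) * Real.exp (-(1 / 4)) = 1 := by
            rw [← Real.exp_add]; simp
          have h3 := Real.exp_pos (1 / 4)
          nlinarith
  calc 4 * (n * b * (1 + a) ^ n) ≤ 4 * (1 / 32 * (4 / 3)) := by gcongr
    _ ≤ 1 / 5 := by norm_num

/-- A round contains about `2ℓ / x` steps, so the separation grows by about `exp (2ℓ) = (24√d /
η)²`. One factor `√d / η` offsets the initial size `ησ / (4√d)`; the rest exceeds `4B`, since `ηB ≤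
LB ≤ σ`. -/
lemma ParameterBounds.growth (h : ParameterBounds d N L ρ σ η δ B ℓ) (hη : 0 < η)
    (hσ : 0 < σ) (hd : 0 < d) (hN : 2 ≤ N) (hδL : 16 * δ ≤ L)
    (hg : 1 + 16 * η * δ ≤ g) (hn : 2 * ℓ / (16 * η * δ) - 2 ≤ n) {s : ℝ}
    (hs : η * (σ / (4 * √(d : ℝ))) ≤ s) : 4 * B < g ^ n * s := by
  have hδ := h.delta_pos
  have hδ1 := h.delta_le
  have hB := h.radius_pos
  have hηℓ := h.eta_mul_le hη hN
  have hηδ := h.eta_le_delta hη hN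
  have hℓ := h.one_le_log
  have hd1 : (1 : ℝ) ≤ √(d : ℝ) := Real.one_le_sqrt.2 (by exact_mod_cast hd)
  set x := 16 * η * δ with hx
  have hx0 : 0 < x := by positivity
  have hx1 : x ≤ 1 / 48 := by
    have : η * δ ≤ η * 1 := by gcongr
    rw [hx]; nlinarith
  have hℓx : ℓ * x ≤ 1 / 48 := by
    have : (η * ℓ) * δ ≤ (1 / 768) * 1 := by gcongr; linarith
    rw [hx]; linarith
  have hlog : x * (1 - x) ≤ Real.log (1 + x) := by
    have h1 := Real.one_sub_inv_le_log_of_pos (x := 1 + x) (by linarith)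
    refine le_trans ?_ h1
    rw [le_sub_iff_add_le, ← le_sub_iff_add_le', inv_le_iff_one_le_mul₀ (by linarith)]
    nlinarith [pow_pos hx0 3]
  -- The two missing steps and the gap between `log (1 + x)` and `x` cost at most `2ℓx + 2x ≤ 1/12`
  -- in the exponent.
  have hnlog : 2 * ℓ - 1 ≤ n * Real.log (1 + x) := by
    have h1 : (2 * ℓ / x - 2) * (x * (1 - x)) ≤ n * Real.log (1 + x) := by
      have : 0 ≤ x * (1 - x) := mul_nonneg hx0.le (by linarith)
      gcongr
    have h2 : (2 * ℓ / x - 2) * (x * (1 - x)) = 2 * ℓ - 2 * (ℓ * x) - 2 * x + 2 * x ^ 2 := by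
      field_simp
      ring
    nlinarith
  have hgn : Real.exp (2 * ℓ - 1) ≤ g ^ n := by
    calc Real.exp (2 * ℓ - 1) ≤ Real.exp (n * Real.log (1 + x)) := Real.exp_le_exp.2 hnlog
      _ = (1 + x) ^ n := by rw [Real.exp_nat_mul, Real.exp_log (by linarith)]
      _ ≤ g ^ n := by gcongr
  -- 192 = 24² / 3, with `e < 3`.
  have hexp : 192 * √(d : ℝ) ^ 2 / η ^ 2 ≤ Real.exp (2 * ℓ - 1) := by
    rw [Real.exp_sub, two_mul, Real.exp_add, h.exp_log, le_div_iff₀ (Real.exp_pos 1)]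
    have := Real.exp_one_lt_three.le
    calc 192 * √(d : ℝ) ^ 2 / η ^ 2 * Real.exp 1 ≤ 192 * √(d : ℝ) ^ 2 / η ^ 2 * 3 := by gcongr
      _ = _ := by field_simp; norm_num
  have hηL : η ≤ L := by linarith
  have hηB : η * B ≤ σ := by
    have := mul_le_mul_of_nonneg_right hηL hB.le
    linarith [h.mul_radius_le]
  calc 4 * B < 48 * √(d : ℝ) * σ / η := by
        rw [lt_div_iff₀ hη]
        nlinarith
    _ = 192 * √(d : ℝ) ^ 2 / η ^ 2 * (η * (σ / (4 * √(d : ℝ)))) := by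
        field_simp; norm_num
    _ ≤ g ^ n * s := by
        have := hexp.trans hgn
        have h0 : 0 ≤ η * (σ / (4 * √(d : ℝ))) := by positivity
        exact mul_le_mul this hs h0 (le_trans (by positivity) this)

lemma ParameterBounds.eta_mul_lipschitz_le (h : ParameterBounds d N L ρ σ η δ B ℓ) (hη : 0 < η)
    (hL : 0 < L) (hN : 2 ≤ N) : η * L ≤ 1 := by
  have hN' : (2 : ℝ) ≤ N := by exact_mod_cast hN
  have hδ := h.delta_pos
  have hB := h.radius_pos
  have hℓ := h.one_le_log
  have h1 : 192 * η * (2 * 2 * 1) * L ≤ 1 := by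
    calc _ ≤ 192 * η * (2 * N * ℓ) * L := by gcongr
      _ ≤ B ^ 2 * δ * L := mul_le_mul_of_nonneg_right h.eta_le hL.le
      _ = B * δ * (L * B) := by ring
      _ ≤ 1 * 1 * 1 := by gcongr; exacts [h.radius_le, h.delta_le, h.mul_radius_le_one]
      _ = 1 := by norm_num
  nlinarith

end Parameters

/-! ### Survival of one round, and the escape theorem -/

section Main

variable {d : ℕ} {Z : Type*} [MeasurableSpace Z] {D : Measure Z} [IsProbabilityMeasure D]
  {F : E d → Z → ℝ} {L ρ σ ε p η : ℝ} {x₀ : E d}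

lemma lambdaMin_of_dim_zero (A : E 0 →L[ℝ] E 0) : lambdaMin A = 0 := by
  have : {μ : ℝ | Module.End.HasEigenvalue (A : E 0 →ₗ[ℝ] E 0) μ} = ∅ := by
    ext μ
    simp only [Set.mem_ofPred_eq, Set.mem_empty_iff_false, iff_false]
    intro h
    obtain ⟨v, hv⟩ := h.exists_hasEigenvector
    exact hv.2 (Subsingleton.elim _ _)
  rw [lambdaMin, this, Real.sInf_empty]

lemma roundLength_eq (d : ℕ) (ρ ε η : ℝ) :
    roundLength d ρ ε η = 2 * Real.log (24 * √(d : ℝ) / η) / (16 * η * delta ρ ε) := by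
  unfold roundLength deltaTwo
  rw [div_eq_mul_inv, mul_assoc _ η⁻¹, ← mul_inv]
  congr 2
  ring

lemma survival_round_le (hF : IsStochasticObjective F D) (hs : Smoothness F D L ρ)
    (hdisp : DispersiveNoise F D σ) (hparam : ParameterSetting d L ρ σ ε p η)
    (hx₀ : lambdaMin (hessian (objective F D) x₀) ≤ -deltaTwo ρ ε) (x : E d) :
    survival D (sgdStep F η) (Metric.closedBall x₀ (radius d ρ ε p η))
      ⌊roundLength d ρ ε η⌋₊ x ≤ ENNReal.ofReal (7 / 10) := by
  have hη := hparam.eta_pos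
  have hL := hparam.L_pos
  have hρ := hparam.rho_pos
  have hδ : 0 < delta ρ ε := Real.sqrt_pos.2 (mul_pos hparam.rho_pos hparam.eps_pos)
  have hneg : lambdaMin (hessian (objective F D) x₀) < 0 := by
    refine hx₀.trans_lt ?_
    unfold deltaTwo
    linarith
  have hd : 0 < d := by
    rcases Nat.eq_zero_or_pos d with rfl | hd
    · rw [lambdaMin_of_dim_zero] at hneg
      exact absurd hneg (lt_irrefl _)
    · exact hd
  have hN := two_le_rounds hparam.p_pos hparam.p_lt_one
  have hb := hparam.bounds hd
  set H := hessian (objective F D) x₀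
  set B := radius d ρ ε p η
  have hB := hb.radius_pos
  obtain ⟨v, hv, hHv⟩ := exists_eigenvector_lambdaMin hneg
  have hHL : ‖H‖ ≤ L := norm_hessian_le hL.le (norm_gradient_sub_le hF hs hL.le) x₀
  have hδL : 16 * delta ρ ε ≤ L := by
    have h1 := H.le_opNorm v
    rw [hHv, norm_smul, hv, mul_one, mul_one, Real.norm_eq_abs, abs_of_neg hneg] at h1
    unfold deltaTwo at hx₀
    linarith
  set g := 1 - η * lambdaMin H with hg
  have hgδ : 1 + 16 * η * delta ρ ε ≤ g := by
    unfold deltaTwo at hx₀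
    rw [hg]
    nlinarith
  have hg1 : 1 ≤ g := le_trans (by have : 0 ≤ 16 * η * delta ρ ε := by positivity
                                   linarith) hgδ
  have hK := hb.le_roundLength hη hN
  rw [← roundLength_eq] at hK
  -- The first step of the round is spent on the dispersive noise and the other `n` amplify the
  -- separation. Together with the floor this leaves `n ≥ K_o - 2`.
  obtain ⟨n, hn⟩ : ∃ n, ⌊roundLength d ρ ε η⌋₊ = n + 1 :=
    Nat.exists_eq_succ_of_ne_zero (Nat.floor_pos.2 (by linarith)).ne'
  have hn1 : ((n : ℝ) + 1) ≤ roundLength d ρ ε η := by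
    have := Nat.floor_le (show 0 ≤ roundLength d ρ ε η by linarith)
    rw [hn] at this
    exact_mod_cast this
  have hn2 : roundLength d ρ ε η < n + 1 + 1 := by
    have := Nat.lt_floor_add_one (roundLength d ρ ε η)
    rw [hn] at this
    exact_mod_cast this
  rw [hn]
  refine survival_succ_le hF hs hη hdisp hv n (fun u q hq => ?_) x
  have hdpos : (0 : ℝ) < √(d : ℝ) := Real.sqrt_pos.2 (by exact_mod_cast hd)
  have hq0 : 0 < q := lt_of_lt_of_le (by have := hparam.sigma_pos; positivity) hq
  refine (survival_coupled_le hF hs hL.le hρ.le hη.le hg1 hv ?_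
    (norm_sub_smul_apply_le (isSymmetric_hessian hs.contDiff x₀) hHL hη.le
      (hb.eta_mul_lipschitz_le hη hL hN) hneg.le)
    (a := 4 * (η * (ρ * B)) + 2 * (η * (ρ * B)) ^ 2 + 2 * (η * L) ^ 2)
    (b := (η * (ρ * B)) / 2 + 2 * (η * (ρ * B)) ^ 2 + 2 * (η * L) ^ 2)
    (by positivity) (by positivity) ?_ n u (u + q • v) hq0 ?_).trans (ENNReal.ofReal_le_ofReal ?_)
  · rw [hHv, hg]
    module
  -- Uses `2t ≤ 2t² + 1/2` and `(t + 1)² ≤ 2t² + 2`; the first leaves only `β / 2` in the additive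
  -- term.
  · intro t ht
    have hβ : 0 ≤ η * (ρ * B) := by positivity
    generalize η * (ρ * B) = β at hβ
    generalize η * L = α
    nlinarith [mul_nonneg hβ (sq_nonneg (2 * t - 1)), mul_nonneg (sq_nonneg β) (sq_nonneg (t - 1)),
      mul_nonneg (sq_nonneg α) (sq_nonneg (t - 1))]
  · refine hb.growth hη hparam.sigma_pos hd hN hδL hgδ ?_ hq
    rw [← roundLength_eq]
    linarith
  -- With reference scale `q` the initial deviation is exactly zero, so only the accumulated term
  -- remains.
  · rw [add_sub_cancel_left, smul_smul, inv_mul_cancel₀ hq0.ne', one_smul, sub_self, norm_zero]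
    have := hb.deviation_le (n := n) hη hL hρ hN (by rw [← roundLength_eq]; linarith) rfl rfl
    simpa using this

end Main

end SGDEscape

theorem mainTheorem3
    {d : ℕ} {Z : Type*} [MeasurableSpace Z] (D : Measure Z) [IsProbabilityMeasure D]
    (F : SGDEscape.E d → Z → ℝ) (L ρ σ ε p η : ℝ)
    (hF : SGDEscape.IsStochasticObjective F D)
    (hsmooth : SGDEscape.Smoothness F D L ρ)
    (hnoise : SGDEscape.BoundedNoise F D σ ∨ SGDEscape.SubgaussianNoise F D σ)
    (hdisp : SGDEscape.DispersiveNoise F D σ)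
    (hparam : SGDEscape.ParameterSetting d L ρ σ ε p η)
    {Ω : Type*} [MeasurableSpace Ω] (P : Measure Ω) [IsProbabilityMeasure P]
    (ζ : ℕ → Ω → Z) (hζ_meas : ∀ k, Measurable (ζ k))
    (hζ_law : ∀ k, P.map (ζ k) = D) (hζ_indep : iIndepFun ζ P)
    (x₀ : SGDEscape.E d)
    (hx₀ : SGDEscape.lambdaMin (SGDEscape.hessian (SGDEscape.objective F D) x₀)
      ≤ -SGDEscape.deltaTwo ρ ε) :
    1 - p / 3 ≤ P.real {ω |
      ((SGDEscape.exitTime (SGDEscape.sgd F η ζ x₀) (SGDEscape.radius d ρ ε p η) ω : ℕ∞) : ℝ≥0∞)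
        ≤ ENNReal.ofReal (SGDEscape.maxSteps d ρ ε p η)} := by
  open SGDEscape in
  set A := {ω | ((exitTime (sgd F η ζ x₀) (radius d ρ ε p η) ω : ℕ∞) : ℝ≥0∞)
    ≤ ENNReal.ofReal (maxSteps d ρ ε p η)}
  -- Rounds have integer length `⌊K_o⌋`, so all `N` of them fit within `N * K_o = K₀` steps.
  set m := rounds p * ⌊roundLength d ρ ε η⌋₊ with hm
  have hstay : P.real {ω | ∀ k ≤ m, sgd F η ζ x₀ k ω ∈ Metric.closedBall x₀ (radius d ρ ε p η)}
      ≤ p / 3 := by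
    have h1 := measure_forall_mem_le_survival (measurable_sgdStep (η := η) hF hsmooth)
      (measurableSet_closedBall (x := x₀) (ε := radius d ρ ε p η)) hζ_meas hζ_law hζ_indep
      (x := sgd F η ζ x₀) (fun _ => rfl) (fun _ _ => rfl) m
    have h2 := h1.trans (survival_mul_le (measurable_sgdStep hF hsmooth)
      measurableSet_closedBall (survival_round_le hF hsmooth hdisp hparam hx₀) (rounds p) x₀)
    rw [← ENNReal.ofReal_pow (by norm_num)] at h2
    exact (ENNReal.toReal_le_of_le_ofReal (by positivity) h2).trans (pow_rounds_le hparam.p_pos)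
  -- A covering with subadditivity replaces complements, so no measurability of the exit event is
  -- needed.
  have hcover : (Set.univ : Set Ω) ⊆ A ∪
      {ω | ∀ k ≤ m, sgd F η ζ x₀ k ω ∈ Metric.closedBall x₀ (radius d ρ ε p η)} := by
    intro ω _
    by_contra! hω
    rw [Set.mem_union, not_or] at hω
    obtain ⟨hA, hω⟩ := hω
    simp only [Set.mem_ofPred_eq, not_forall] at hω
    obtain ⟨k, hk, hkB⟩ := hω
    refine hA ?_
    have hexit : exitTime (sgd F η ζ x₀) (radius d ρ ε p η) ω ≤ k := by
      refine iInf₂_le k ?_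
      rw [Metric.mem_closedBall, not_le, dist_eq_norm] at hkB
      exact hkB
    have hK : 0 ≤ roundLength d ρ ε η := by
      have h1 := hparam.one_le_maxSteps
      unfold maxSteps at h1
      by_contra! h2
      have : (0 : ℝ) ≤ rounds p := Nat.cast_nonneg _
      nlinarith
    have hkm : (k : ℝ) ≤ maxSteps d ρ ε p η := by
      calc (k : ℝ) ≤ m := by exact_mod_cast hk
        _ ≤ maxSteps d ρ ε p η := by
          rw [hm, maxSteps]
          push_cast
          gcongr
          exact Nat.floor_le hK
    calc ((exitTime (sgd F η ζ x₀) (radius d ρ ε p η) ω : ℕ∞) : ℝ≥0∞)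
        ≤ ((k : ℕ∞) : ℝ≥0∞) := ENat.toENNReal_le.2 hexit
      _ = ENNReal.ofReal k := by simp
      _ ≤ _ := ENNReal.ofReal_le_ofReal hkm
  have h1 : 1 ≤ P.real A
      + P.real {ω | ∀ k ≤ m, sgd F η ζ x₀ k ω ∈ Metric.closedBall x₀ (radius d ρ ε p η)} := by
    rw [← probReal_univ (μ := P)]
    exact (measureReal_mono hcover).trans (measureReal_union_le _ _)
  linarith
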